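/- \textbf{Theorem.} Consider one-pass randomized streaming algorithms that are first given an integer $\kappa$ and then an insertion-only stream listing, in arbitrary order and each exactly once, the edges of a simple graph $G$ on the vertex set $\{1,\dots,n\}$ whose degeneracy is $\kappa$ (the degeneracy of $G$ is the least $k$ such that every nonempty induced subgraph of $G$ has a vertex of degree at most $k$). For a nonnegative integer $\lambda$, possibly depending on $n$ and $\kappa$, we say that such an algorithm $(\kappa+\lambda)$-colours $n$-vertex graphs if, for every $\kappa$, every $G$ of degeneracy $\kappa$ on $\{1,\dots,n\}$ and every ordering of its edges, it outputs with probability at least $2/3$ a proper colouring of $G$ with colours from a palette of $\kappa+\lambda$ colours. The space of the algorithm is the number of bits of memory carried from one stream element to the next; its computing power, its access to $\kappa$, $n$, the position in the stream, and its access to a random seed are unrestricted. (1) There is an absolute constant $c>0$ such that for all integers $\lambda\ge 1$ and $n\ge 5\lambda$, every such algorithm that $(\kappa+\lambda)$-colours $n$-vertex graphs uses at least $c\,n^2/\lambda^2$ bits of space. (2) Let $\gamma>0$ and let $\lambda=\lambda(n,\kappa)$ be nonnegative integers with $\lambda(n,\kappa)=O(\kappa^{1/2-\gamma})$, that is, there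 are $K$ and $\kappa_0$ with $\lambda(n,\kappa)\le K\kappa^{1/2-\gamma}$ for all $n$ and all $\kappa\ge\kappa_0$. Then there is no semi-streaming algorithm for $(\kappa+\lambda(n,\kappa))$-colouring: there is no family $(A_n)_{n\ge 0}$ such that $A_n$ $(\kappa+\lambda(n,\kappa))$-colours $n$-vertex graphs for every $n$ and $A_n$ uses $s(n)$ bits of space with $s(n)=O(n\log^d n)$ for some constant $d$. -/

import Mathlib

open MeasureTheory

universe u

namespace StreamColoring

/-- `G` is `k`-degenerate: every (nonempty) induced subgraph has a vertex of degree at most `k`. -/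
def IsDegenerate {V : Type*} (G : SimpleGraph V) (k : ℕ) : Prop :=
  ∀ S : Set V, S.Nonempty → ∃ v : S, ((G.induce S).neighborSet v).encard ≤ k

/-- The degeneracy of a finite graph: the smallest `k` such that `G` is `k`-degenerate. -/
noncomputable def degeneracy {V : Type*} [Finite V] (G : SimpleGraph V) : ℕ :=
  sInf {k : ℕ | IsDegenerate G k}

/-- `f` is a proper `c`-colouring of `G`, with palette `{0, …, c - 1}`. -/
def IsProperColoring {V : Type*} (G : SimpleGraph V) (c : ℕ) (f : V → ℕ) : Prop :=
  (∀ v, f v < c) ∧ ∀ u v, G.Adj u v → f u ≠ f v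

/-- `σ` is an insertion-only stream building up `G`: it lists every edge of `G` exactly once,
in some order. -/
def IsEdgeStream {V : Type*} (G : SimpleGraph V) (σ : List (Sym2 V)) : Prop :=
  σ.Nodup ∧ ∀ e, e ∈ σ ↔ e ∈ G.edgeSet

/-- A deterministic one-pass algorithm on streams of edges of graphs on the vertex set `Fin n`
whose memory consists of `s` bits, and which outputs a colour for each vertex. It is told an
integer `k` before the stream starts. The memory is initialised, then rewritten once for every
edge of the stream, and the output is computed from its final content. The model is
non-uniform: no bound is put on computing power, and the integer `k` and the position `t` in the
stream can be consulted for free at any time. -/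
structure DetAlgorithm (n s : ℕ) where
  init : (k : ℕ) → (Fin s → Bool)
  step : (k t : ℕ) → (Fin s → Bool) → Sym2 (Fin n) → (Fin s → Bool)
  output : (k : ℕ) → (Fin s → Bool) → (Fin n → ℕ)

/-- The colouring output by a deterministic algorithm on the input `k` followed by the
stream `σ`. -/
def DetAlgorithm.run {n s : ℕ} (A : DetAlgorithm n s) (k : ℕ) (σ : List (Sym2 (Fin n))) :
    Fin n → ℕ :=
  A.output k (σ.zipIdx.foldl (fun q e => A.step k e.2 q e.1) (A.init k))

/-- A randomized one-pass algorithm with `s` bits of memory: a random choice of a deterministic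
one, such that the output on each input is a random variable. The random seed can be consulted
for free at any time. (Algorithms that toss fresh private coins at every step are included:
the seed then consists of independent coins for each position `t` of the stream.) -/
structure RandAlgorithm (n s : ℕ) where
  Seed : Type u
  measurableSpace : MeasurableSpace Seed
  μ : Measure Seed
  isProbabilityMeasure : IsProbabilityMeasure μ
  alg : Seed → DetAlgorithm n s
  measurable_run : ∀ (k : ℕ) (σ : List (Sym2 (Fin n))), Measurable fun ω => (alg ω).run k σ

/-- Given the degeneracy `κ` of an arbitrary graph `G` on `Fin n`, followed by the edges of `G` in
arbitrary order, the algorithm outputs a proper `(κ + lam κ)`-colouring of `G` with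
probability at least `2/3`. -/
def RandAlgorithm.Colors {n s : ℕ} (A : RandAlgorithm.{u} n s) (lam : ℕ → ℕ) : Prop :=
  ∀ (G : SimpleGraph (Fin n)) (κ : ℕ), degeneracy G = κ →
    ∀ σ : List (Sym2 (Fin n)), IsEdgeStream G σ →
      letI := A.measurableSpace
      (2 / 3 : ℝ) ≤ A.μ.real {ω | IsProperColoring G (κ + lam κ) ((A.alg ω).run κ σ)}

/-- The space bound `s` is semi-streaming, i.e. `s(n) = O(n · polylog n)`. -/
def IsSemiStreaming (s : ℕ → ℕ) : Prop :=
  ∃ d : ℕ, (fun n : ℕ => (s n : ℝ)) =O[Filter.atTop] fun n : ℕ => (n : ℝ) * Real.log n ^ d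

end StreamColoring

/-!
Part of the stream encodes a string of bits and the rest asks for one of them, so an algorithm that
colours well solves the one-way communication problem INDEX, and its memory is at least the number
of bits times the capacity of a binary symmetric channel.

Bits are indexed by `Fin p × Fin p`. Row `i` has a block of `l` vertices, and column `j` has one
block of `l` vertices for each of the two values a bit may take. The bit at `(i, j)` is encoded by
joining the block of `i` completely to the one of the two blocks of `j` that the bit selects. To
ask for the bit at `(i, j)`, the rest of the stream makes two cliques, which share extra vertices:
one on the block of `i`, the other on both blocks of `j`. The selected block of `j` is now in a
clique with either of the two other blocks, and so are the extra vertices. The union of the three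
blocks and the extra vertices has `κ + 1 + l` vertices, where `κ + 1` is the size of each of these
two cliques. If only `κ + l` colours are available, then a colour repeats, and this can only happen
between the block of `i` and the block of `j` that was not selected: the colouring reveals the bit.
The degeneracy is `κ`, for every string and query, if `p * l ≤ κ`.
-/

namespace StreamColoring

section Index

open Finset Real

variable {ι M : Type*} [Fintype ι] {δ : ℝ}

/-- The capacity, in bits, of the binary symmetric channel that transmits a bit correctly with
probability `δ`. -/
noncomputable def bscCapacity (δ : ℝ) : ℝ :=
  1 - binEntropy δ / log 2

theorem bscCapacity_pos (hδ : δ ≠ 2⁻¹) : 0 < bscCapacity δ := by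
  rw [bscCapacity, sub_pos, div_lt_one (log_pos one_lt_two)]
  exact binEntropy_lt_log_two.2 hδ

theorem log_two_mul_bscCapacity (δ : ℝ) :
    log 2 * bscCapacity δ = log 2 + (δ * log δ + (1 - δ) * log (1 - δ)) := by
  have hlog : log 2 ≠ 0 := (log_pos one_lt_two).ne'
  rw [bscCapacity, binEntropy, log_inv, log_inv]
  field_simp
  ring

theorem sum_prod_ite_eq {R : Type*} [CommSemiring R] [DecidableEq ι] (y : ι → Bool) (a b : R) :
    ∑ x : ι → Bool, ∏ i, (if y i = x i then a else b) = (a + b) ^ Fintype.card ι := by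
  rw [← Fintype.prod_sum fun i c => if y i = c then a else b]
  refine (prod_congr rfl fun i _ => ?_).trans (prod_const _)
  cases y i <;> simp [add_comm]

theorem log_prod_ite {p : ι → Prop} [DecidablePred p] {a b : ℝ} (ha : a ≠ 0) (hb : b ≠ 0) :
    log (∏ i, if p i then a else b) =
      #{i | p i} * (log a - log b) + Fintype.card ι * log b := by
  have hcard : (#{i | p i} : ℝ) + #{i | ¬ p i} = Fintype.card ι := by
    exact_mod_cast card_filter_add_card_filter_not (s := univ) p
  rw [prod_ite, prod_const, prod_const, log_mul (pow_ne_zero _ ha) (pow_ne_zero _ hb), log_pow,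
    log_pow, ← hcard]
  ring

theorem sum_log_le_card_mul_log {α : Type*} [Fintype α] [Nonempty α] {w : α → ℝ}
    (hw : ∀ a, 0 < w a) {W : ℝ} (hW : ∑ a, w a ≤ W) :
    ∑ a, log (w a) ≤ Fintype.card α * (log W - log (Fintype.card α)) := by
  have hα : (0 : ℝ) < Fintype.card α := by exact_mod_cast Fintype.card_pos
  have hpos : 0 < ∑ a, w a := sum_pos (fun a _ => hw a) univ_nonempty
  have jensen := strictConcaveOn_log_Ioi.concaveOn.le_map_sum (t := univ)
    (w := fun _ : α => (Fintype.card α : ℝ)⁻¹) (p := w) (fun _ _ => by positivity)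
    (by simp) (fun a _ => hw a)
  simp only [smul_eq_mul, ← mul_sum] at jensen
  rw [← log_div (hpos.trans_le hW).ne' hα.ne', ← inv_mul_le_iff₀ hα, div_eq_inv_mul]
  exact jensen.trans (log_le_log (by positivity) (by gcongr))

-- Decoding `m` into the string `y` makes the strings `x` agreeing with `y` the likely outputs of a
-- binary symmetric channel fed with `y`; these likelihoods add up to one for each message.
theorem card_mul_bscCapacity_le [DecidableEq ι] [Fintype M] (enc : (ι → Bool) → M)
    (dec : M → ι → Bool) (hδ : 1 / 2 ≤ δ) (hδ1 : δ < 1)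
    (h : δ * (2 ^ Fintype.card ι * Fintype.card ι) ≤
      (#{q : (ι → Bool) × ι | dec (enc q.1) q.2 = q.1 q.2} : ℝ)) :
    Fintype.card ι * bscCapacity δ ≤ logb 2 (Fintype.card M) := by
  set N : ℝ := (Fintype.card ι : ℝ)
  let likelihood (m : M) (x : ι → Bool) : ℝ := ∏ i, if dec m i = x i then δ else 1 - δ
  have likelihood_pos (m x) : 0 < likelihood m x :=
    prod_pos fun i _ => by split_ifs <;> linarith
  have total : ∑ x, likelihood (enc x) x ≤ Fintype.card M := calc
    ∑ x, likelihood (enc x) x ≤ ∑ x, ∑ m, likelihood m x := sum_le_sum fun x _ =>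
      single_le_sum (fun m _ => (likelihood_pos m x).le) (mem_univ (enc x))
    _ = ∑ m, ∑ x, likelihood m x := sum_comm
    _ = Fintype.card M := by simp [likelihood, sum_prod_ite_eq]
  have upper := sum_log_le_card_mul_log (fun x => likelihood_pos (enc x) x) total
  have lower : 2 ^ Fintype.card ι * N * (δ * log δ + (1 - δ) * log (1 - δ)) ≤
      ∑ x, log (likelihood (enc x) x) := calc
    _ = δ * (2 ^ Fintype.card ι * N) * (log δ - log (1 - δ)) +
        2 ^ Fintype.card ι * (N * log (1 - δ)) := by ring
    _ ≤ (#{q : (ι → Bool) × ι | dec (enc q.1) q.2 = q.1 q.2} : ℝ) * (log δ - log (1 - δ)) +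
        2 ^ Fintype.card ι * (N * log (1 - δ)) := by
      gcongr
      exact sub_nonneg.2 (log_le_log (by linarith) (by linarith))
    _ = ∑ x, log (likelihood (enc x) x) := by
      simp_rw [likelihood, log_prod_ite (show δ ≠ 0 by linarith) (show 1 - δ ≠ 0 by linarith),
        sum_add_distrib, ← sum_mul, card_filter, Fintype.sum_prod_type]
      simp [N, mul_assoc]
  rw [← log_div_log, le_div_iff₀ (log_pos one_lt_two)]
  have hcard : ((Fintype.card (ι → Bool) : ℕ) : ℝ) = 2 ^ Fintype.card ι := by simp
  rw [hcard, log_pow] at upper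
  have key := le_of_mul_le_mul_left ((mul_assoc _ _ _).symm.trans_le (lower.trans upper))
    (by positivity)
  linear_combination key + N * log_two_mul_bscCapacity δ

theorem exists_mul_card_le_card_filter {Ω T : Type*} [MeasurableSpace Ω] (μ : Measure Ω)
    [IsProbabilityMeasure μ] [Fintype T] {P : T → Ω → Prop} [∀ ω, DecidablePred (P · ω)]
    (hP : ∀ t, MeasurableSet {ω | P t ω}) (h : ∀ t, δ ≤ μ.real {ω | P t ω}) :
    ∃ ω, δ * Fintype.card T ≤ #{t | P t ω} := by
  have hint (t) : Integrable ({ω | P t ω}.indicator (1 : Ω → ℝ)) μ :=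
    (integrable_const 1).indicator (hP t)
  obtain ⟨ω, hω⟩ := exists_integral_le (integrable_finsetSum univ fun t _ => hint t)
  refine ⟨ω, ?_⟩
  calc δ * Fintype.card T = ∑ _t : T, δ := by simp [mul_comm]
    _ ≤ ∑ t, μ.real {ω | P t ω} := sum_le_sum fun t _ => h t
    _ = ∫ ω, ∑ t, {ω | P t ω}.indicator 1 ω ∂μ := by
      rw [integral_finsetSum _ fun t _ => hint t]
      exact sum_congr rfl fun t _ => (integral_indicator_one (hP t)).symm
    _ ≤ ∑ t, {ω | P t ω}.indicator 1 ω := hω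
    _ = #{t | P t ω} := by
      rw [card_filter, Nat.cast_sum]
      exact sum_congr rfl fun t _ => by simp [Set.indicator_apply]

theorem card_mul_bscCapacity_le_of_index_protocol {Ω : Type*} [MeasurableSpace Ω] (μ : Measure Ω)
    [IsProbabilityMeasure μ] [Fintype M]
    (enc : Ω → (ι → Bool) → M) (dec : Ω → M → ι → Bool) (hδ : 1 / 2 ≤ δ) (hδ1 : δ < 1)
    (hmeas : ∀ x i, MeasurableSet {ω | dec ω (enc ω x) i = x i})
    (hprob : ∀ x i, δ ≤ μ.real {ω | dec ω (enc ω x) i = x i}) :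
    Fintype.card ι * bscCapacity δ ≤ logb 2 (Fintype.card M) := by
  classical
  obtain ⟨ω, hω⟩ := exists_mul_card_le_card_filter μ
    (P := fun (q : (ι → Bool) × ι) ω => dec ω (enc ω q.1) q.2 = q.1 q.2)
    (fun q => hmeas q.1 q.2) (fun q => hprob q.1 q.2)
  refine card_mul_bscCapacity_le (enc ω) (dec ω) hδ hδ1 (le_of_eq_of_le ?_ hω)
  simp

end Index

section Degeneracy

variable {V W : Type*} {G : SimpleGraph V} {k : ℕ}

theorem isDegenerate_iff_encard_neighborSet_inter :
    IsDegenerate G k ↔ ∀ S : Set V, S.Nonempty → ∃ v ∈ S, (G.neighborSet v ∩ S).encard ≤ k := by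
  have hcard (S : Set V) (v : S) :
      ((G.induce S).neighborSet v).encard = (G.neighborSet v ∩ S).encard := by
    rw [← Subtype.val_injective.encard_image]
    congr 1
    ext w
    simp [and_comm]
  simp only [IsDegenerate, hcard, Subtype.exists, exists_prop]

theorem IsDegenerate.of_rank {α : Type*} [LinearOrder α] [WellFoundedLT α] (rank : V → α)
    (h : ∀ v, ∃ C : Set V, v ∈ C ∧ C.encard ≤ k + 1 ∧
      ∀ w, G.Adj v w → rank v ≤ rank w → w ∈ C) : IsDegenerate G k := by
  rw [isDegenerate_iff_encard_neighborSet_inter]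
  intro S hS
  obtain ⟨v, hvS, hmin⟩ := exists_minimalFor_of_wellFoundedLT (· ∈ S) rank hS
  obtain ⟨C, hvC, hcard, hC⟩ := h v
  have hneighbors : G.neighborSet v ∩ S ⊆ C \ {v} := fun w hw =>
    ⟨hC w hw.1 ((le_total (rank v) (rank w)).elim id (hmin hw.2)), hw.1.ne'⟩
  refine ⟨v, hvS, (Set.encard_le_encard hneighbors).trans ?_⟩
  rwa [← ENat.add_le_add_iff_right ENat.one_ne_top, Set.encard_sdiff_singleton_add_one hvC]

theorem IsDegenerate.map (h : IsDegenerate G k) (f : V ↪ W) : IsDegenerate (G.map f) k := by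
  rw [isDegenerate_iff_encard_neighborSet_inter] at h ⊢
  intro S hS
  by_cases hf : (f ⁻¹' S).Nonempty
  · obtain ⟨v, hv, hcard⟩ := h _ hf
    refine ⟨f v, hv, ?_⟩
    rwa [SimpleGraph.neighborSet_map, ← Set.image_inter_preimage, f.injective.encard_image]
  · obtain ⟨w, hw⟩ := hS
    refine ⟨w, hw, ?_⟩
    have hempty : (G.map f).neighborSet w ∩ S = ∅ := by
      refine Set.eq_empty_of_forall_notMem fun w' hw' => ?_
      obtain ⟨-, v', -, -, rfl⟩ := (SimpleGraph.map_adj _ _ _ _).1 hw'.1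
      exact hf ⟨v', hw'.2⟩
    simp [hempty]

theorem IsDegenerate.encard_le_of_isClique (h : IsDegenerate G k) {C : Set V}
    (hC : G.IsClique C) : C.encard ≤ k + 1 := by
  rcases C.eq_empty_or_nonempty with rfl | hne
  · simp
  obtain ⟨v, hv, hcard⟩ := isDegenerate_iff_encard_neighborSet_inter.1 h C hne
  have hneighbors : C \ {v} ⊆ G.neighborSet v ∩ C := fun w hw =>
    ⟨hC hv hw.1 (Ne.symm hw.2), hw.1⟩
  rw [← Set.encard_sdiff_singleton_add_one hv]
  gcongr
  exact (Set.encard_le_encard hneighbors).trans hcard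

theorem degeneracy_eq_of_isClique [Finite V] (h : IsDegenerate G k) {C : Set V}
    (hC : G.IsClique C) (hk : C.encard = k + 1) : degeneracy G = k := by
  refine le_antisymm (Nat.sInf_le h) (le_csInf ⟨k, h⟩ fun m hm => ?_)
  have hle : ((k + 1 : ℕ) : ℕ∞) ≤ (m + 1 : ℕ) := by
    exact_mod_cast hk ▸ IsDegenerate.encard_le_of_isClique hm hC
  exact Nat.succ_le_succ_iff.1 (Nat.cast_le.1 hle)

end Degeneracy

section ProperColoring

variable {V W : Type*} {G : SimpleGraph V} {c c' : ℕ}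

theorem IsProperColoring.mono {g : V → ℕ} (hg : IsProperColoring G c g) (hc : c ≤ c') :
    IsProperColoring G c' g :=
  ⟨fun v => (hg.1 v).trans_le hc, hg.2⟩

theorem IsProperColoring.comp_embedding {f : V ↪ W} {g : W → ℕ}
    (hg : IsProperColoring (G.map f) c g) : IsProperColoring G c (g ∘ f) :=
  ⟨fun v => hg.1 (f v), fun _ _ h => hg.2 _ _ ((SimpleGraph.map_adj_apply).2 h)⟩

theorem IsProperColoring.exists_eq_of_isClique_union {g : V → ℕ} (hg : IsProperColoring G c g)
    {P Q R : Set V} (hPR : G.IsClique (P ∪ R)) (hQR : G.IsClique (Q ∪ R))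
    (hc : c < (P ∪ Q ∪ R).encard) : ∃ v ∈ P, ∃ w ∈ Q, g v = g w := by
  obtain ⟨v, hv, w, hw, hne, hvw⟩ := Set.exists_ne_map_eq_of_encard_lt_of_maps_to
    (t := {a : ℕ | a < c}) (by rwa [Set.Nat.encard_range]) (fun v _ => hg.1 v)
  have hP : ¬ (v ∈ P ∪ R ∧ w ∈ P ∪ R) := fun h => hg.2 v w (hPR h.1 h.2 hne) hvw
  have hQ : ¬ (v ∈ Q ∪ R ∧ w ∈ Q ∪ R) := fun h => hg.2 v w (hQR h.1 h.2 hne) hvw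
  have hcross : v ∈ P ∧ w ∈ Q ∨ w ∈ P ∧ v ∈ Q := by grind
  rcases hcross with ⟨hv, hw⟩ | ⟨hw, hv⟩
  exacts [⟨v, hv, w, hw, hvw⟩, ⟨w, hw, v, hv, hvw.symm⟩]

end ProperColoring

section EdgeStream

variable {V W : Type*} {G H : SimpleGraph V} {σ τ : List (Sym2 V)}

theorem exists_isEdgeStream [Finite V] (G : SimpleGraph V) : ∃ σ, IsEdgeStream G σ :=
  ⟨G.edgeSet.toFinite.toFinset.toList, Finset.nodup_toList _, fun e => by simp⟩

theorem isEdgeStream_fromEdgeSet_range {ι : Type*} [Fintype ι] {f : ι → Sym2 V}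
    (hf : f.Injective) (hdiag : ∀ i, ¬ (f i).IsDiag) :
    IsEdgeStream (SimpleGraph.fromEdgeSet (Set.range f)) (Finset.univ.toList.map f) := by
  refine ⟨(Finset.nodup_toList _).map hf, fun e => ?_⟩
  simp only [List.mem_map, Finset.mem_toList, Finset.mem_univ, true_and,
    SimpleGraph.edgeSet_fromEdgeSet, Set.mem_sdiff, Set.mem_range, Sym2.mem_diagSet]
  exact ⟨fun ⟨i, hi⟩ => ⟨⟨i, hi⟩, hi ▸ hdiag i⟩, And.left⟩

theorem IsEdgeStream.append (hσ : IsEdgeStream G σ) (hτ : IsEdgeStream H τ)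
    (hGH : Disjoint G H) : IsEdgeStream (G ⊔ H) (σ ++ τ) := by
  have hdisj : Disjoint G.edgeSet H.edgeSet := SimpleGraph.disjoint_edgeSet.2 hGH
  refine ⟨hσ.1.append hτ.1 fun e he he' =>
    Set.disjoint_left.1 hdisj ((hσ.2 e).1 he) ((hτ.2 e).1 he'), fun e => ?_⟩
  rw [List.mem_append, hσ.2, hτ.2, SimpleGraph.edgeSet_sup, Set.mem_union]

theorem IsEdgeStream.map (hσ : IsEdgeStream G σ) (f : V ↪ W) :
    IsEdgeStream (G.map f) (σ.map f.sym2Map) := by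
  refine ⟨hσ.1.map f.sym2Map.injective, fun e => ?_⟩
  rw [List.mem_map, SimpleGraph.edgeSet_map]
  exact exists_congr fun e' => and_congr_left fun _ => hσ.2 e'

end EdgeStream

section Encard

variable {α β : Type*} [Fintype α]

theorem encard_insert_range_le {k : ℕ} (hk : Fintype.card α ≤ k) (f : α → β) (b : β) :
    (insert b (Set.range f)).encard ≤ k + 1 := calc
  (insert b (Set.range f)).encard ≤ (Set.range f).encard + 1 := Set.encard_insert_le _ _
  _ ≤ Fintype.card α + 1 := by
    gcongr
    rw [← Set.image_univ, ← ENat.card_eq_coe_fintype_card, ← Set.encard_univ]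
    exact Set.encard_image_le _ _
  _ ≤ k + 1 := by gcongr

theorem encard_range_eq_card {f : α → β} (hf : f.Injective) :
    (Set.range f).encard = Fintype.card α := by
  rw [← Set.image_univ, hf.encard_image, Set.encard_univ, ENat.card_eq_coe_fintype_card]

end Encard

section HardGraph

variable {I J L K : Type*}

/-- The vertices of the graphs into which a string of bits indexed by `I × J` is encoded. There is
a block of vertices indexed by `L` for each `i : I`, the *left* blocks, and for each pair of
`b : Bool` and `j : J`, the *right* blocks; the vertices indexed by `K` are there to adjust the
degeneracy. -/
inductive Vertex (I J L K : Type*)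
  | left (i : I) (t : L)
  | right (b : Bool) (j : J) (t : L)
  | extra (c : K)

namespace Vertex

/-- The vertices as a sum of product types, by which they are counted. -/
def equivSum : Vertex I J L K ≃ (I × L) ⊕ (Bool × J × L) ⊕ K where
  toFun
    | left i t => .inl (i, t)
    | right b j t => .inr (.inl (b, j, t))
    | extra c => .inr (.inr c)
  invFun := Sum.elim (fun q => left q.1 q.2)
    (Sum.elim (fun q => right q.1 q.2.1 q.2.2) extra)
  left_inv v := by cases v <;> rfl
  right_inv v := by rcases v with _ | _ | _ <;> rfl

theorem nonempty_embedding_fin [Fintype I] [Fintype J] [Fintype L] [Fintype K] {n : ℕ}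
    (h : (Fintype.card I + 2 * Fintype.card J) * Fintype.card L + Fintype.card K ≤ n) :
    Nonempty (Vertex I J L K ↪ Fin n) := by
  obtain ⟨f⟩ : Nonempty ((I × L) ⊕ (Bool × J × L) ⊕ K ↪ Fin n) := by
    refine Function.Embedding.nonempty_of_card_le ?_
    simp only [Fintype.card_sum, Fintype.card_prod, Fintype.card_bool, Fintype.card_fin]
    linarith
  exact ⟨equivSum.toEmbedding.trans f⟩

/-- The block of `L` vertices on the left that represents `i`. -/
def leftBlock (i : I) : Set (Vertex I J L K) := Set.range (left i)

/-- The block of `L` vertices on the right that represents the value `b` of the bits in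
column `j`. -/
def rightBlock (b : Bool) (j : J) : Set (Vertex I J L K) := Set.range (right b j)

/-- The vertices that are in no block. -/
def extras : Set (Vertex I J L K) := Set.range extra

theorem encard_leftBlock [Fintype L] (i : I) :
    (leftBlock i : Set (Vertex I J L K)).encard = Fintype.card L :=
  encard_range_eq_card fun _ _ h => (left.inj h).2

theorem encard_rightBlock [Fintype L] (b : Bool) (j : J) :
    (rightBlock b j : Set (Vertex I J L K)).encard = Fintype.card L :=
  encard_range_eq_card fun _ _ h => (right.inj h).2.2

theorem encard_extras [Fintype K] :
    (extras : Set (Vertex I J L K)).encard = Fintype.card K :=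
  encard_range_eq_card fun _ _ h => extra.inj h

variable [Fintype L] [Fintype K]

theorem encard_rightBlock_union_extras (b : Bool) (j : J) :
    (rightBlock b j ∪ extras : Set (Vertex I J L K)).encard =
      Fintype.card L + Fintype.card K := by
  rw [Set.encard_union_eq, encard_rightBlock, encard_extras]
  simp [rightBlock, extras, Set.disjoint_left]

theorem encard_leftBlock_union (i : I) (b : Bool) (j : J) :
    (leftBlock i ∪ (rightBlock b j ∪ extras) : Set (Vertex I J L K)).encard =
      2 * Fintype.card L + Fintype.card K := by
  rw [Set.encard_union_eq, encard_leftBlock, encard_rightBlock_union_extras, two_mul, add_assoc]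
  simp [leftBlock, rightBlock, extras, Set.disjoint_left]

theorem encard_rightBlock_not_union (b : Bool) (j : J) :
    (rightBlock (!b) j ∪ (rightBlock b j ∪ extras) : Set (Vertex I J L K)).encard =
      2 * Fintype.card L + Fintype.card K := by
  rw [Set.encard_union_eq, encard_rightBlock, encard_rightBlock_union_extras, two_mul, add_assoc]
  simp [rightBlock, extras, Set.disjoint_left]

theorem encard_leftBlock_union_rightBlock_union (i : I) (b : Bool) (j : J) :
    (leftBlock i ∪ rightBlock (!b) j ∪ (rightBlock b j ∪ extras) : Set (Vertex I J L K)).encard =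
      3 * Fintype.card L + Fintype.card K := by
  rw [Set.union_assoc, Set.encard_union_eq, encard_leftBlock, encard_rightBlock_not_union,
    ← add_assoc, ← one_add_mul]
  · norm_num
  · simp [leftBlock, rightBlock, extras, Set.disjoint_left]

instance [Finite I] [Finite J] [Finite L] [Finite K] : Finite (Vertex I J L K) :=
  Finite.of_equiv _ equivSum.symm

end Vertex

open Vertex

/-- The pairs of vertices by which the bit `x (i, j)` is encoded: they connect the block of `i` to
that of `(x (i, j), j)`. -/
def encodingEdge (x : I × J → Bool) (q : (I × J) × (L × L)) : Sym2 (Vertex I J L K) :=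
  s(left q.1.1 q.2.1, right (x q.1) q.1.2 q.2.2)

/-- The graph built by the first part of the stream, which depends on the whole string `x`. -/
def encodingGraph (x : I × J → Bool) : SimpleGraph (Vertex I J L K) :=
  SimpleGraph.fromEdgeSet (Set.range (encodingEdge x))

/-- The graph built by the second part of the stream, which asks for the bit at `e`: a union of
two cliques. -/
def queryGraph (e : I × J) : SimpleGraph (Vertex I J L K) :=
  SimpleGraph.fromEdgeSet
    ((leftBlock e.1 ∪ extras).sym2 ∪ ((⋃ b, rightBlock b e.2) ∪ extras).sym2)

/-- The graph from whose colourings the bit of `x` at `e` can be recovered. -/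
def hardGraph (x : I × J → Bool) (e : I × J) : SimpleGraph (Vertex I J L K) :=
  encodingGraph x ⊔ queryGraph e

variable (x : I × J → Bool) (e : I × J)

theorem disjoint_encodingGraph_queryGraph :
    Disjoint (encodingGraph x : SimpleGraph (Vertex I J L K)) (queryGraph e) := by
  refine SimpleGraph.disjoint_left.2 fun v w hx he => ?_
  cases v <;> cases w <;>
    simp_all [encodingGraph, encodingEdge, queryGraph, leftBlock, rightBlock, extras]

theorem hardGraph_adj (v w : Vertex I J L K) :
    (hardGraph x e).Adj v w ↔ match v, w with
      | left i _, right b j _ | right b j _, left i _ => x (i, j) = b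
      | left i _, left i' _ => (e.1 = i ∧ e.1 = i') ∧ v ≠ w
      | right _ j _, right _ j' _ => (e.2 = j ∧ e.2 = j') ∧ v ≠ w
      | left i _, extra _ | extra _, left i _ => e.1 = i
      | right _ j _, extra _ | extra _, right _ j _ => e.2 = j
      | extra _, extra _ => v ≠ w := by
  cases v <;> cases w <;>
    simp [hardGraph, encodingGraph, encodingEdge, queryGraph, leftBlock, rightBlock, extras]

theorem isClique_leftBlock_union :
    (hardGraph x e).IsClique
      (leftBlock e.1 ∪ (rightBlock (x e) e.2 ∪ extras) : Set (Vertex I J L K)) := by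
  intro v hv w hw hne
  rw [hardGraph_adj]
  cases v <;> cases w <;> grind [leftBlock, rightBlock, extras]

theorem isClique_rightBlock_union (b : Bool) :
    (hardGraph x e).IsClique
      (rightBlock (!b) e.2 ∪ (rightBlock b e.2 ∪ extras) : Set (Vertex I J L K)) := by
  intro v hv w hw hne
  rw [hardGraph_adj]
  cases v <;> cases w <;> grind [rightBlock, extras]

open Classical in
/-- A rank for which every vertex of `hardGraph x e` has few neighbours of at least its rank:
first the blocks that are not queried, then the left block that is, then the vertices of
the other queried clique. -/
noncomputable def degeneracyRank : Vertex I J L K → ℕ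
  | left i _ => if i = e.1 then 1 else 0
  | right _ j _ => if j = e.2 then 2 else 0
  | extra _ => 2

section Degeneracy

variable [Fintype I] [Fintype J] [Fintype L] [Fintype K] {κ : ℕ}

theorem isDegenerate_hardGraph (hI : Fintype.card I * Fintype.card L ≤ κ)
    (hJ : Fintype.card J * Fintype.card L ≤ κ)
    (hκ : 2 * Fintype.card L + Fintype.card K = κ + 1) :
    IsDegenerate (hardGraph x e : SimpleGraph (Vertex I J L K)) κ := by
  rw [← Fintype.card_prod] at hI hJ
  have hclique : (2 * Fintype.card L + Fintype.card K : ℕ∞) ≤ κ + 1 := by exact_mod_cast hκ.le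
  refine IsDegenerate.of_rank (degeneracyRank e) fun v => ?_
  by_cases hv₀ : degeneracyRank e v = 0
  · cases v with
    | left i t =>
      refine ⟨_, Set.mem_insert _ _,
        encard_insert_range_le hJ (fun q => right (x (i, q.1)) q.1 q.2) _, fun w hw hr => ?_⟩
      rw [hardGraph_adj] at hw
      cases w <;> simp_all [degeneracyRank]
    | right b j t =>
      refine ⟨_, Set.mem_insert _ _,
        encard_insert_range_le hI (fun q => left q.1 q.2) _, fun w hw hr => ?_⟩
      rw [hardGraph_adj] at hw
      cases w <;> simp_all [degeneracyRank]
    | extra k => simp [degeneracyRank] at hv₀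
  by_cases hv₁ : degeneracyRank e v = 1
  · refine ⟨leftBlock e.1 ∪ (rightBlock (x e) e.2 ∪ extras), ?_,
      (encard_leftBlock_union _ _ _).trans_le hclique, fun w hw hr => ?_⟩
    · cases v <;> simp_all [degeneracyRank, leftBlock, rightBlock, extras]
    rw [hardGraph_adj] at hw
    cases v <;> cases w <;> grind [degeneracyRank, leftBlock, rightBlock, extras]
  · have hright (b : Bool) (t : L) :
        (right b e.2 t : Vertex I J L K) ∈
          rightBlock (!true) e.2 ∪ (rightBlock true e.2 ∪ extras) := by
      cases b <;> simp [rightBlock, extras]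
    refine ⟨rightBlock (!true) e.2 ∪ (rightBlock true e.2 ∪ extras), ?_,
      (encard_rightBlock_not_union _ _).trans_le hclique, fun w hw hr => ?_⟩
    · cases v <;> grind [degeneracyRank, extras]
    rw [hardGraph_adj] at hw
    cases v <;> cases w <;> grind [degeneracyRank, extras]

theorem degeneracy_map_hardGraph {W : Type*} [Finite W] (f : Vertex I J L K ↪ W)
    (hI : Fintype.card I * Fintype.card L ≤ κ) (hJ : Fintype.card J * Fintype.card L ≤ κ)
    (hκ : 2 * Fintype.card L + Fintype.card K = κ + 1) :
    degeneracy ((hardGraph x e).map f) = κ := by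
  refine degeneracy_eq_of_isClique ((isDegenerate_hardGraph x e hI hJ hκ).map f)
    (isClique_leftBlock_union x e).map ?_
  rw [f.injective.encard_image, encard_leftBlock_union]
  exact_mod_cast hκ

end Degeneracy

theorem exists_color_eq_iff [Fintype L] [Fintype K] {W : Type*} (f : Vertex I J L K ↪ W) {c : ℕ}
    (hc : c < 3 * Fintype.card L + Fintype.card K) {g : W → ℕ}
    (hg : IsProperColoring ((hardGraph x e).map f) c g) :
    (∃ t t', g (f (left e.1 t)) = g (f (right false e.2 t'))) ↔ x e = true := by
  have hgf := hg.comp_embedding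
  have hshared : ∃ v ∈ leftBlock e.1, ∃ w ∈ rightBlock (!x e) e.2, g (f v) = g (f w) :=
    hgf.exists_eq_of_isClique_union (isClique_leftBlock_union x e)
      (isClique_rightBlock_union x e (x e)) (by
        rw [encard_leftBlock_union_rightBlock_union]
        exact_mod_cast hc)
  refine ⟨fun ⟨t, t', h⟩ => ?_, fun hx => ?_⟩
  · by_contra hx
    exact hgf.2 _ _ ((hardGraph_adj x e (left _ t) (right _ _ t')).2 (by simpa using hx)) h
  · obtain ⟨_, ⟨t, rfl⟩, _, ⟨t', rfl⟩, h⟩ := hshared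
    exact ⟨t, t', by simpa [hx] using h⟩

section Stream

variable [Fintype I] [Fintype J] [Fintype L]

/-- A stream for `encodingGraph x` whose length does not depend on `x`. -/
noncomputable def encodingStream (x : I × J → Bool) : List (Sym2 (Vertex I J L K)) :=
  Finset.univ.toList.map (encodingEdge x)

theorem length_encodingStream :
    (encodingStream x : List (Sym2 (Vertex I J L K))).length =
      Fintype.card ((I × J) × (L × L)) := by
  rw [encodingStream, List.length_map, Finset.length_toList, Finset.card_univ]

theorem isEdgeStream_encodingStream :
    IsEdgeStream (encodingGraph x : SimpleGraph (Vertex I J L K)) (encodingStream x) := by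
  refine isEdgeStream_fromEdgeSet_range (fun q q' h => ?_) fun q => ?_
  · grind [encodingEdge]
  · simp [encodingEdge]

variable [Finite K]

/-- A stream for `queryGraph e`. -/
noncomputable def queryStream : List (Sym2 (Vertex I J L K)) :=
  (exists_isEdgeStream (queryGraph e)).choose

theorem isEdgeStream_queryStream :
    IsEdgeStream (queryGraph e : SimpleGraph (Vertex I J L K)) (queryStream e) :=
  (exists_isEdgeStream (queryGraph e)).choose_spec

theorem isEdgeStream_encodingStream_append_queryStream :
    IsEdgeStream (hardGraph x e : SimpleGraph (Vertex I J L K))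
      (encodingStream x ++ queryStream e) :=
  (isEdgeStream_encodingStream x).append (isEdgeStream_queryStream e)
    (disjoint_encodingGraph_queryGraph x e)

end Stream

end HardGraph

section Streaming

variable {n s : ℕ}

namespace DetAlgorithm

/-- The content of the memory after the stream `σ`. -/
def stateAfter (A : DetAlgorithm n s) (k : ℕ) (σ : List (Sym2 (Fin n))) : Fin s → Bool :=
  σ.zipIdx.foldl (fun q e => A.step k e.2 q e.1) (A.init k)

/-- The output if the memory contains `q` at position `t` and the stream continues with `τ`. -/
def runFrom (A : DetAlgorithm n s) (k t : ℕ) (q : Fin s → Bool) (τ : List (Sym2 (Fin n))) :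
    Fin n → ℕ :=
  A.output k ((τ.zipIdx t).foldl (fun q e => A.step k e.2 q e.1) q)

theorem run_append (A : DetAlgorithm n s) (k : ℕ) (σ τ : List (Sym2 (Fin n))) :
    A.run k (σ ++ τ) = A.runFrom k σ.length (A.stateAfter k σ) τ := by
  simp [run, runFrom, stateAfter, List.zipIdx_append]

end DetAlgorithm

namespace RandAlgorithm

attribute [instance] measurableSpace isProbabilityMeasure

variable {A : RandAlgorithm.{u} n s} {κ c c' : ℕ} {δ : ℝ}

-- The memory content between the two streams is the message of a one-way protocol.
theorem card_mul_bscCapacity_le_of_decode (A : RandAlgorithm.{u} n s) (κ : ℕ) {ι : Type*}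
    [Fintype ι] {σ : (ι → Bool) → List (Sym2 (Fin n))} {τ : ι → List (Sym2 (Fin n))} {t : ℕ}
    (hσ : ∀ x, (σ x).length = t) (decode : ι → (Fin n → ℕ) → Bool) (hδ : 1 / 2 ≤ δ) (hδ1 : δ < 1)
    (h : ∀ x i, δ ≤ A.μ.real {ω | decode i ((A.alg ω).run κ (σ x ++ τ i)) = x i}) :
    Fintype.card ι * bscCapacity δ ≤ s := by
  have hrun (ω x i) : (A.alg ω).runFrom κ t ((A.alg ω).stateAfter κ (σ x)) (τ i) =
      (A.alg ω).run κ (σ x ++ τ i) := by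
    rw [DetAlgorithm.run_append, hσ]
  have key := card_mul_bscCapacity_le_of_index_protocol A.μ
    (fun ω x => (A.alg ω).stateAfter κ (σ x))
    (fun ω q i => decode i ((A.alg ω).runFrom κ t q (τ i))) hδ hδ1
    (fun x i => by
      simp only [hrun]
      exact A.measurable_run κ (σ x ++ τ i) (.of_discrete (s := {g | decode i g = x i})))
    (fun x i => by simpa only [hrun] using h x i)
  simpa [Real.logb_pow] using key

/-- The algorithm properly colours every graph of degeneracy `κ` with `c` colours, with probability
at least `δ`. -/
def ColorsWith (A : RandAlgorithm.{u} n s) (κ c : ℕ) (δ : ℝ) : Prop :=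
  ∀ G : SimpleGraph (Fin n), degeneracy G = κ → ∀ σ : List (Sym2 (Fin n)), IsEdgeStream G σ →
    δ ≤ A.μ.real {ω | IsProperColoring G c ((A.alg ω).run κ σ)}

theorem ColorsWith.mono (h : A.ColorsWith κ c δ) (hc : c ≤ c') : A.ColorsWith κ c' δ :=
  fun G hG σ hσ => (h G hG σ hσ).trans (measureReal_mono fun _ hω => hω.mono hc)

theorem Colors.colorsWith {lam : ℕ → ℕ} (h : A.Colors lam) (κ : ℕ) :
    A.ColorsWith κ (κ + lam κ) (2 / 3) :=
  fun G hG σ hσ => h G κ hG σ hσ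

-- The graph has `3 * p * l` vertices in blocks and `κ + 1 - 2 * l` extra ones: `hn` says that these
-- are at most `n` vertices, without truncated subtraction.
theorem ColorsWith.sq_mul_bscCapacity_le {p l : ℕ} (hA : A.ColorsWith κ (κ + l) δ)
    (hδ : 1 / 2 ≤ δ) (hδ1 : δ < 1) (hlκ : 2 * l ≤ κ + 1) (hp : p * l ≤ κ)
    (hn : 3 * p * l + κ + 1 ≤ n + 2 * l) : p ^ 2 * bscCapacity δ ≤ s := by
  classical
  obtain ⟨k, hk⟩ : ∃ k, 2 * l + k = κ + 1 := ⟨κ + 1 - 2 * l, by lia⟩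
  obtain ⟨f⟩ : Nonempty (Vertex (Fin p) (Fin p) (Fin l) (Fin k) ↪ Fin n) := by
    refine Vertex.nonempty_embedding_fin ?_
    simp only [Fintype.card_fin]
    linarith
  have key := A.card_mul_bscCapacity_le_of_decode κ
    (σ := fun x => (encodingStream x).map f.sym2Map) (τ := fun e => (queryStream e).map f.sym2Map)
    (fun x => (List.length_map _).trans (length_encodingStream x))
    (fun e g => decide (∃ t t', g (f (.left e.1 t)) = g (f (.right false e.2 t')))) hδ hδ1
    (fun x e => by
      refine (hA _ (degeneracy_map_hardGraph x e f ?_ ?_ ?_) _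
        ((isEdgeStream_encodingStream_append_queryStream x e).map f)).trans
        (measureReal_mono fun ω hω => ?_)
      · simpa using hp
      · simpa using hp
      · simpa using hk
      · rw [Set.mem_ofPred_eq, List.map_append] at hω
        rw [Set.mem_ofPred_eq, Bool.eq_iff_iff, decide_eq_true_iff]
        refine exists_color_eq_iff x e f ?_ hω
        simp only [Fintype.card_fin]
        linarith)
  simpa [sq] using key

theorem Colors.div_mul_sq_div_sq_le {l : ℕ} (hA : A.Colors fun _ => l) (hl : 1 ≤ l)
    (hn : 4 * l ≤ n) : bscCapacity (2 / 3) / 64 * ((n : ℝ) ^ 2 / (l : ℝ) ^ 2) ≤ s := by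
  obtain ⟨p, hp, hpn, hnp⟩ : ∃ p, 1 ≤ p ∧ 4 * l * p ≤ n ∧ n ≤ 8 * p * l := by
    have hp := (Nat.one_le_div_iff (show 0 < 4 * l by lia)).2 hn
    have hlt := Nat.lt_mul_div_succ n (show 0 < 4 * l by lia)
    exact ⟨n / (4 * l), hp, Nat.mul_div_le _ _, by nlinarith⟩
  obtain ⟨κ, hκ⟩ : ∃ κ, (p + 1) * l = κ + 1 :=
    Nat.exists_eq_add_one_of_ne_zero (by positivity)
  have hcapacity := (hA.colorsWith κ).sq_mul_bscCapacity_le (p := p) (by norm_num) (by norm_num)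
    (by nlinarith) (by nlinarith) (by nlinarith)
  have hdiv : (n / l : ℝ) ≤ 8 * p := by
    rw [div_le_iff₀ (by positivity)]
    exact_mod_cast hnp
  have hpos : 0 < bscCapacity (2 / 3) := bscCapacity_pos (by norm_num)
  calc bscCapacity (2 / 3) / 64 * ((n : ℝ) ^ 2 / (l : ℝ) ^ 2)
      = bscCapacity (2 / 3) / 64 * (n / l : ℝ) ^ 2 := by rw [div_pow]
    _ ≤ bscCapacity (2 / 3) / 64 * (8 * p) ^ 2 := by gcongr
    _ = p ^ 2 * bscCapacity (2 / 3) := by ring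
    _ ≤ s := hcapacity

end RandAlgorithm

end Streaming

section Asymptotics

open Filter Asymptotics Real Topology

theorem isLittleO_natCast_rpow {a b : ℝ} (hab : a < b) :
    (fun n : ℕ => (n : ℝ) ^ a) =o[atTop] fun n : ℕ => (n : ℝ) ^ b := by
  have htendsto : Tendsto (fun n : ℕ => (n : ℝ) ^ (-(b - a))) atTop (𝓝 0) :=
    (tendsto_rpow_neg_atTop (sub_pos.2 hab)).comp tendsto_natCast_atTop_atTop
  refine isLittleO_of_tendsto' ?_ (htendsto.congr' ?_)
  all_goals
    filter_upwards [eventually_gt_atTop 0] with n hn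
    have hn' : (0 : ℝ) < n := by exact_mod_cast hn
  · exact fun h => absurd h (by positivity)
  · rw [neg_sub, rpow_sub hn']

theorem IsSemiStreaming.isLittleO_rpow {s : ℕ → ℕ} (hs : IsSemiStreaming s) {ε : ℝ} (hε : 0 < ε) :
    (fun n => (s n : ℝ)) =o[atTop] fun n => (n : ℝ) ^ (1 + ε) := by
  obtain ⟨d, hd⟩ := hs
  have hlog : (fun n : ℕ => log n ^ d) =o[atTop] fun n : ℕ => (n : ℝ) ^ ε := by
    simpa [Function.comp_def] using (isLittleO_log_rpow_rpow_atTop (d : ℝ) hε).comp_tendsto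
      tendsto_natCast_atTop_atTop
  refine (hd.trans_isLittleO ((isBigO_refl _ _).mul_isLittleO hlog)).congr_right fun n => ?_
  rw [rpow_one_add' n.cast_nonneg (by positivity)]

namespace RandAlgorithm

theorem ColorsWith.sq_le {m s l : ℕ} {δ : ℝ} {A : RandAlgorithm.{u} (4 * m) s}
    (hA : A.ColorsWith m (m + l) δ) (hδ : 1 / 2 < δ) (hδ1 : δ < 1) (hl : 1 ≤ l) (hlm : 2 * l ≤ m) :
    (m : ℝ) ^ 2 ≤ 4 / bscCapacity δ * (l ^ 2 * s) := by
  have hpos : 0 < bscCapacity δ := bscCapacity_pos (by norm_num; linarith)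
  have hpm : l * (m / l) ≤ m := Nat.mul_div_le _ _
  have hmp : (m : ℝ) ≤ 2 * l * (m / l : ℕ) := by
    have hlt := Nat.lt_mul_div_succ m (show 0 < l by lia)
    exact_mod_cast (show m ≤ 2 * l * (m / l) by nlinarith)
  have hcapacity := hA.sq_mul_bscCapacity_le (p := m / l) hδ.le hδ1 (by lia) (by linarith)
    (by linarith)
  calc (m : ℝ) ^ 2 ≤ (2 * l * (m / l : ℕ)) ^ 2 := by gcongr
    _ = 4 / bscCapacity δ * (l ^ 2 * ((m / l : ℕ) ^ 2 * bscCapacity δ)) := by field_simp; ring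
    _ ≤ 4 / bscCapacity δ * (l ^ 2 * s) := by gcongr

theorem isBigO_rpow_of_colorsWith {s l : ℕ → ℕ} {β δ : ℝ} (A : ∀ m, RandAlgorithm.{u} (4 * m) (s m))
    (hA : ∀ m, (A m).ColorsWith m (m + l m) δ) (hδ : 1 / 2 < δ) (hδ1 : δ < 1)
    (hl : (fun m => (l m : ℝ)) =O[atTop] fun m => (m : ℝ) ^ β) (hβ : 0 ≤ β) (hβ1 : β < 1) :
    (fun m : ℕ => (m : ℝ) ^ (2 - 2 * β)) =O[atTop] fun m => (s m : ℝ) := by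
  have hone : (fun _ : ℕ => (1 : ℝ)) =O[atTop] fun m : ℕ => (m : ℝ) ^ β := by
    refine .of_bound' ?_
    filter_upwards [eventually_ge_atTop 1] with m hm
    rw [norm_one]
    exact (one_le_rpow (by exact_mod_cast hm) hβ).trans (le_norm_self _)
  have hsucc : (fun m => ((l m + 1 : ℕ) : ℝ)) =O[atTop] fun m : ℕ => (m : ℝ) ^ β := by
    simpa using hl.add hone
  have hlt : (fun m : ℕ => (m : ℝ) ^ β) =o[atTop] fun m : ℕ => (m : ℝ) := by
    simpa using isLittleO_natCast_rpow hβ1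
  have hsq : (fun m : ℕ => (m : ℝ) ^ 2) =O[atTop] fun m => ((l m + 1 : ℕ) : ℝ) ^ 2 * s m := by
    refine .of_bound (4 / bscCapacity δ) ?_
    filter_upwards [(hsucc.trans_isLittleO hlt).def one_half_pos] with m hm
    rw [RCLike.norm_natCast, RCLike.norm_natCast] at hm
    have hle : 2 * (l m + 1) ≤ m := by
      exact_mod_cast (show 2 * ((l m + 1 : ℕ) : ℝ) ≤ m by linarith)
    rw [norm_of_nonneg (by positivity), norm_of_nonneg (by positivity)]
    exact ((hA m).mono (by lia)).sq_le hδ hδ1 (by lia) hle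
  have hmul := (isBigO_refl (fun m : ℕ => ((m : ℝ) ^ (2 * β))⁻¹) atTop).mul
    (hsq.trans ((hsucc.pow 2).mul (isBigO_refl _ _)))
  refine hmul.congr' ?_ ?_
  all_goals
    filter_upwards [eventually_gt_atTop 0] with m hm
    have hm' : (0 : ℝ) < m := by exact_mod_cast hm
  · rw [rpow_sub hm', rpow_two, inv_mul_eq_div]
  · rw [← rpow_mul_natCast hm'.le, mul_comm β, Nat.cast_two, inv_mul_cancel_left₀ (by positivity)]

end RandAlgorithm

theorem not_isSemiStreaming_of_colors {γ : ℝ} (hγ : 0 < γ) {lam : ℕ → ℕ → ℕ} {K : ℝ} {κ₀ : ℕ}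
    (hlam : ∀ n κ : ℕ, κ₀ ≤ κ → (lam n κ : ℝ) ≤ K * (κ : ℝ) ^ (1 / 2 - γ)) {s : ℕ → ℕ}
    (A : (n : ℕ) → RandAlgorithm.{u} n (s n)) (hA : ∀ n, (A n).Colors (lam n)) :
    ¬ IsSemiStreaming s := by
  intro hs
  obtain ⟨ε, hε, hεγ, hε2⟩ : ∃ ε, 0 < ε ∧ ε ≤ γ ∧ ε ≤ 1 / 2 :=
    ⟨min γ (1 / 2), by positivity, min_le_left _ _, min_le_right _ _⟩
  have hl : (fun m => (lam (4 * m) m : ℝ)) =O[atTop] fun m : ℕ => (m : ℝ) ^ (1 / 2 - ε) := by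
    refine .of_bound |K| ?_
    filter_upwards [eventually_ge_atTop κ₀, eventually_ge_atTop 1] with m hm hm1
    rw [norm_of_nonneg (by positivity), norm_of_nonneg (by positivity)]
    refine (hlam (4 * m) m hm).trans ?_
    gcongr
    · exact le_abs_self K
    · exact_mod_cast hm1
  have hlower : (fun m : ℕ => (m : ℝ) ^ (1 + 2 * ε)) =O[atTop] fun m => (s (4 * m) : ℝ) := by
    convert RandAlgorithm.isBigO_rpow_of_colorsWith (fun m => A (4 * m))
      (fun m => (hA (4 * m)).colorsWith m) (by norm_num) (by norm_num) hl (by linarith)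
      (by linarith) using 3
    ring
  have hupper : (fun m => (s (4 * m) : ℝ)) =o[atTop] fun m : ℕ => (m : ℝ) ^ (1 + 2 * ε) := by
    have hscale : Tendsto (fun m => 4 * m) atTop atTop :=
      tendsto_id.const_mul_atTop' (by norm_num : 0 < 4)
    refine ((hs.isLittleO_rpow (mul_pos two_pos hε)).comp_tendsto hscale).trans_isBigO ?_
    simp only [Function.comp_def, Nat.cast_mul, mul_rpow (Nat.cast_nonneg _) (Nat.cast_nonneg _)]
    exact isBigO_const_mul_self _ _ _
  refine isLittleO_irrefl ?_ (hlower.trans_isLittleO hupper)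
  refine Eventually.frequently ?_
  filter_upwards [eventually_gt_atTop 0] with m hm
  positivity

end Asymptotics

end StreamColoring

theorem mainTheorem3 :
    (∃ c : ℝ, 0 < c ∧
      ∀ (lam n : ℕ), 1 ≤ lam → 5 * lam ≤ n →
        ∀ (s : ℕ) (A : StreamColoring.RandAlgorithm.{u} n s),
          A.Colors (fun _ => lam) → c * ((n : ℝ) ^ 2 / (lam : ℝ) ^ 2) ≤ (s : ℝ)) ∧
    (∀ (γ : ℝ), 0 < γ →
      ∀ lam : ℕ → ℕ → ℕ,
        (∃ (K : ℝ) (κ₀ : ℕ), ∀ n κ : ℕ, κ₀ ≤ κ →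
          (lam n κ : ℝ) ≤ K * (κ : ℝ) ^ (1 / 2 - γ)) →
        ¬ ∃ s : ℕ → ℕ, StreamColoring.IsSemiStreaming s ∧
          ∃ A : (n : ℕ) → StreamColoring.RandAlgorithm.{u} n (s n),
            ∀ n, (A n).Colors (lam n)) := by
  refine ⟨⟨StreamColoring.bscCapacity (2 / 3) / 64, ?_, fun lam n hlam hn s A hA =>
    hA.div_mul_sq_div_sq_le hlam (by lia)⟩, ?_⟩
  · exact div_pos (StreamColoring.bscCapacity_pos (by norm_num)) (by norm_num)
  · rintro γ hγ lam ⟨K, κ₀, hlam⟩ ⟨s, hs, A, hA⟩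
    exact StreamColoring.not_isSemiStreaming_of_colors hγ hlam A hA hs
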